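/- Let $R$ be a Dedekind domain with quotient field $K$, let $G$ be a finite group with neutral element $e$ acting on $R$ by ring automorphisms $\sigma_g$ (extended to $K$), and let $R^G$ be the ring of invariants. Let $A = K\diamondsuit_{\sigma,\alpha} G$ be a crystalline graded ring: a ring containing $K$ (with the same unit), together with an injection $u:G\to A\setminus\{0\}$, $u_e=1$, such that $A=\bigoplus_{g\in G}Ku_g$, where $Ku_g=u_gK$ is a free left $K$-module with basis $u_g$ and $u_g x=\sigma_g(x)u_g$ for $x \in K$, where $u_gu_h=\alpha(g,h)u_{gh}$ with $\alpha(g,h)\in K$ (so that $A$ is $G$-graded with $A_g=Ku_g$), and where $\alpha(g,h)x=0$ with $x \in K$ implies $x=0$. A full $R$-lattice in $A$ is a torsion-free sub-$R$-bimodule $M$ of $A$ that is finitely generated both as a left and as a right $R$-module and satisfies $KM=A=MK$. A subset of $A$ is graded if it contains the homogeneous components of all its elements. Let $\Lambda$ be a graded order in $A$, i.e. a subring of $A$ with the same unit that is a graded full $R$-lattice. A two-sided graded Ideal of $\Lambda$ is a two-sided ideal of $\Lambda$ that is graded and is a full $R$-lattice in $A$. Such an Ideal $P\neq\Lambda$ is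 gr-prime if, for all two-sided graded Ideals $S,T$ of $\Lambda$, $ST\subseteq P$ implies $S\subseteq P$ or $T\subseteq P$; it is gr-maximal if it is maximal among the two-sided graded Ideals different from $\Lambda$. Then the gr-prime Ideals of $\Lambda$ coincide with the gr-maximal two-sided Ideals of $\Lambda$. If $P$ is a gr-prime Ideal of $\Lambda$ and $P_e=P\cap A_e$ is its part of degree $e$, then $P_e=P\cap R$; the ideal $p=P\cap R^G=P_e\cap R^G$ is a nonzero prime (hence maximal) ideal of $R^G$, and $p=P_e$ if and only if $G$ acts trivially on $R$; and $\Lambda/P$, with the grading induced by that of $\Lambda$ and the $R^G$-action induced by $R^G \subseteq \Lambda$, is a finite dimensional gr-simple algebra over the field $R^G/p$, that is, it is nonzero and its only graded two-sided ideals are $0$ and $\Lambda/P$. -/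

import Mathlib

namespace Crystalline

/-- Crystalline graded rings `A = B ◇ G`: `ι` embeds the base ring `B` in `A` and `u : G → A` is the
family of homogeneous generators. -/
structure IsCrystallineGraded {B A G : Type*} [Ring B] [Ring A] [Group G]
    (ι : B →+* A) (u : G → A) : Prop where
  ι_injective : Function.Injective ι
  u_injective : Function.Injective u
  u_ne_zero : ∀ g, u g ≠ 0
  u_one : u 1 = 1
  /-- `A` is the direct sum of the `B u_g`, each of them free as a left module with basis `u_g`. -/
  direct_sum : Function.Bijective (fun c : G →₀ B => c.sum fun g b => ι b * u g)
  /-- `B u_g = u_g B`. -/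
  left_eq_right : ∀ g, Set.range (fun b => ι b * u g) = Set.range (fun b => u g * ι b)
  /-- The direct sum is a grading: `(B u_g) (B u_h) ⊆ B u_{gh}`. -/
  graded : ∀ g h, ∀ b c : B, ∃ d : B, (ι b * u g) * (ι c * u h) = ι d * u (g * h)
  /-- Torsion-freeness with respect to the elements `α(g,h)` given by `u_g u_h = α(g,h) u_{gh}`. -/
  torsion_free : ∀ g h, ∀ a r : B, u g * u h = ι a * u (g * h) → a * r = 0 → r = 0

/-- The homogeneous component `A_g = B u_g`. -/
def component {B A G : Type*} [Ring B] [Ring A] (ι : B →+* A) (u : G → A) (g : G) :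
    AddSubgroup A :=
  ((AddMonoidHom.mulRight (u g)).comp ι.toAddMonoidHom).range

/-- A subset `T` of `A` is graded if it contains the homogeneous components `x_g u_g` of each of
its elements `∑ x_g u_g`. -/
def IsGradedSet {B A G : Type*} [Ring B] [Ring A] (ι : B →+* A) (u : G → A) (T : Set A) : Prop :=
  ∀ c : G →₀ B, (c.sum fun g b => ι b * u g) ∈ T → ∀ g, ι (c g) * u g ∈ T

section Lattices

variable (R : Type*) {K A : Type*} [CommRing R] [Field K] [Algebra R K] [Ring A]

/-- The embedding of `R` in `A`, through its fraction field `K`. -/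
def baseHom (ι : K →+* A) : R →+* A := ι.comp (algebraMap R K)

/-- An `R`-lattice in `A`: a sub-`R`-bimodule that is torsion-free and finitely generated, both as
a left and as a right `R`-module. -/
structure IsLattice (ι : K →+* A) (M : AddSubgroup A) : Prop where
  left_mem : ∀ r : R, ∀ x ∈ M, baseHom R ι r * x ∈ M
  right_mem : ∀ r : R, ∀ x ∈ M, x * baseHom R ι r ∈ M
  left_torsion_free : ∀ r : R, ∀ x ∈ M, baseHom R ι r * x = 0 → r = 0 ∨ x = 0
  right_torsion_free : ∀ r : R, ∀ x ∈ M, x * baseHom R ι r = 0 → r = 0 ∨ x = 0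
  left_fg : ∃ s : Finset A,
    M = AddSubgroup.closure {y | ∃ r : R, ∃ x ∈ s, y = baseHom R ι r * x}
  right_fg : ∃ s : Finset A,
    M = AddSubgroup.closure {y | ∃ r : R, ∃ x ∈ s, y = x * baseHom R ι r}

/-- A full `R`-lattice in `A`: `K M = A = M K`. -/
structure IsFullLattice (ι : K →+* A) (M : AddSubgroup A) : Prop extends IsLattice R ι M where
  left_full : AddSubgroup.closure {y | ∃ k : K, ∃ x ∈ M, y = ι k * x} = ⊤
  right_full : AddSubgroup.closure {y | ∃ k : K, ∃ x ∈ M, y = x * ι k} = ⊤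

variable {G : Type*}

/-- A graded `R`-order in `A`: a subring (with the same identity) that is a graded full
`R`-lattice. -/
structure IsGradedOrder (ι : K →+* A) (u : G → A) (Λ : Subring A) : Prop where
  full : IsFullLattice R ι Λ.toAddSubgroup
  graded : IsGradedSet ι u (Λ : Set A)

theorem IsGradedOrder.baseHom_mem {ι : K →+* A} {u : G → A} {Λ : Subring A}
    (hΛ : IsGradedOrder R ι u Λ) (r : R) : baseHom R ι r ∈ Λ := by
  have h := hΛ.full.left_mem r 1 Λ.one_mem
  rwa [mul_one] at h

/-- The invariant ring `R^G`, mapped into the order `Λ`. -/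
def fixedToOrder [Group G] [MulSemiringAction G R] {ι : K →+* A} {u : G → A} {Λ : Subring A}
    (hΛ : IsGradedOrder R ι u Λ) : FixedPoints.subring R G →+* Λ :=
  ((baseHom R ι).comp (FixedPoints.subring R G).subtype).codRestrict Λ
    fun a => hΛ.baseHom_mem R a

/-- An ideal of the order `Λ`, viewed as a subgroup of `A`. -/
def inAmbient {Λ : Subring A} (P : Ideal Λ) : AddSubgroup A :=
  (Submodule.toAddSubgroup P).map Λ.subtype.toAddMonoidHom

/-- Two-sided graded Ideals of `Λ`. All "Ideals" are full `R`-lattices in `A`. -/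
structure IsGrIdeal (ι : K →+* A) (u : G → A) {Λ : Subring A} (P : Ideal Λ) : Prop where
  two_sided : P.IsTwoSided
  full : IsFullLattice R ι (inAmbient P)
  graded : IsGradedSet ι u (inAmbient P : Set A)

/-- gr-prime Ideals of `Λ`. (As `P` is closed under addition, `S T ⊆ P` may be tested on products
of two elements.) -/
structure IsGrPrime (ι : K →+* A) (u : G → A) {Λ : Subring A} (P : Ideal Λ) : Prop where
  gr_ideal : IsGrIdeal R ι u P
  proper : P ≠ ⊤
  prime : ∀ S T : Ideal Λ, IsGrIdeal R ι u S → IsGrIdeal R ι u T →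
    (∀ s ∈ S, ∀ t ∈ T, s * t ∈ P) → S ≤ P ∨ T ≤ P

/-- gr-maximal two-sided Ideals of `Λ`: maximal among the proper two-sided graded Ideals. -/
structure IsGrMaximal (ι : K →+* A) (u : G → A) {Λ : Subring A} (P : Ideal Λ) : Prop where
  gr_ideal : IsGrIdeal R ι u P
  proper : P ≠ ⊤
  maximal : ∀ Q : Ideal Λ, IsGrIdeal R ι u Q → Q ≠ ⊤ → P ≤ Q → Q = P

end Lattices

/-- The image in `Λ ⧸ P` of the homogeneous component `Λ_g = Λ ∩ A_g`. -/
def quotientComponent {B A G : Type*} [Ring B] [Ring A] (ι : B →+* A) (u : G → A) {Λ : Subring A}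
    (P : Ideal Λ) [P.IsTwoSided] (g : G) : AddSubgroup (Λ ⧸ P) :=
  ((component ι u g).comap Λ.subtype.toAddMonoidHom).map (Ideal.Quotient.mk P).toAddMonoidHom

open Classical in
/-- A ring `Q` with a `G`-grading `𝒜` is gr-simple if it is nonzero and its only graded two-sided
ideals are `0` and `Q`. -/
structure IsGrSimple {G Q : Type*} [Group G] [Ring Q] (𝒜 : G → AddSubgroup Q) : Prop where
  internal : DirectSum.IsInternal 𝒜
  one_mem : 1 ∈ 𝒜 1
  mul_mem : ∀ g h, ∀ x ∈ 𝒜 g, ∀ y ∈ 𝒜 h, x * y ∈ 𝒜 (g * h)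
  nontrivial : Nontrivial Q
  simple : ∀ J : Ideal Q, J.IsTwoSided →
    (∀ c : G →₀ Q, (∀ g, c g ∈ 𝒜 g) → (c.sum fun _ x => x) ∈ J → ∀ g, c g ∈ J) →
    J = ⊥ ∨ J = ⊤

end Crystalline

/-! If `P` is gr-maximal and `S T ⊆ P`, the residual `{s | s T ⊆ P}` is a graded Ideal containing
`P`. It is either `Λ`, so that `T ⊆ P`, or `P`, so that `S ⊆ P`.

Conversely, let `P` be gr-prime. Norms put nonzero invariants in `P` and invariants are central, so
`p = P ∩ R^G` is a nonzero prime, maximal because `R` is integral over `R^G`. The dimension of `R /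
(P ∩ R)` over `R^G / p` is at most `|G|`: a relation over `R^G` among more than `|G|` elements of
`R` exists by Artin's bound and can be rescaled to be nontrivial modulo `p`
(`exists_fixed_relation_notMem`). Since `Λ` is finitely generated over `R`, the ring `Q = Λ / P` is
finite dimensional, hence Artinian. Gr-primeness says that `a Q b = 0` forces `a = 0` or `b = 0` for
homogeneous `a`, `b` (`IsGrPrime.mem_or_mem`). A graded Brauer lemma (`exists_idempotent`) then
leaves no graded two-sided ideals except `0` and `Q` (`eq_top_of_ne_bot`), so `P` is gr-maximal.

The claims on `P_e` rest on `Λ ∩ K = R`, which holds because `R` is integrally closed. -/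

namespace Crystalline

/-! ### Invariants of a finite group acting on a Dedekind domain -/

section FixedRing

variable {R G : Type*} [CommRing R] [Group G] [MulSemiringAction G R]

instance isInvariant_fixedPoints_subring :
    Algebra.IsInvariant (FixedPoints.subring R G) R G :=
  ⟨fun b hb => ⟨⟨b, hb⟩, rfl⟩⟩

theorem smul_coe_fixed (g : G) (a : FixedPoints.subring R G) : g • (a : R) = a := a.2 g

variable [Finite G]

variable (G) in
/-- A nonzero element of a domain divides a nonzero invariant element. -/
theorem exists_fixed_multiple [IsDomain R] {b : R} (hb : b ≠ 0) :
    ∃ (a : FixedPoints.subring R G) (c : R), a ≠ 0 ∧ (a : R) = c * b := by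
  classical
  cases nonempty_fintype G
  -- The invariant multiple is the norm of `b`.
  refine ⟨⟨∏ g : G, g • b, fun h => ?_⟩, ∏ g ∈ Finset.univ.erase (1 : G), g • b, ?_, ?_⟩
  · rw [Finset.smul_prod']
    simp_rw [smul_smul]
    exact Fintype.prod_equiv (Equiv.mulLeft h) _ _ fun _ => rfl
  · intro h
    obtain ⟨g, -, hg⟩ := Finset.prod_eq_zero_iff.1 (congrArg Subtype.val h)
    exact hb ((smul_eq_zero_iff_eq g).1 hg)
  · change ∏ g : G, g • b = _
    rw [← Finset.prod_erase_mul _ _ (Finset.mem_univ (1 : G)), one_smul]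

/-- More than `|G|` elements of a domain are linearly dependent over the invariants. -/
theorem exists_fixed_relation [IsDomain R] {κ : Type*} [Fintype κ]
    (hκ : Nat.card G < Fintype.card κ) (x : κ → R) :
    ∃ a : κ → FixedPoints.subring R G, a ≠ 0 ∧ ∑ i, (a i : R) * x i = 0 := by
  classical
  cases nonempty_fintype G
  let F := FractionRing R
  let : MulSemiringAction G F := IsFractionRing.mulSemiringAction G R F
  have hsm (g : G) (r : R) : algebraMap R F (g • r) = g • algebraMap R F r :=
    algebraMap.coe_smul' (B := R) (C := F) g r
  have hinj : Function.Injective (algebraMap R F) := IsFractionRing.injective R F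
  -- Artin: `F` has dimension at most `|G|` over its fixed field.
  have hdep : ¬ LinearIndependent (FixedPoints.subfield G F) fun i => algebraMap R F (x i) := by
    intro h
    have h1 := h.fintype_card_le_finrank
    have h2 := FixedPoints.finrank_le_card G F
    rw [Nat.card_eq_fintype_card] at hκ
    omega
  obtain ⟨c, hc, j, hj⟩ := Fintype.not_linearIndependent_iff.1 hdep
  obtain ⟨b, hb⟩ := IsLocalization.exist_integer_multiples (nonZeroDivisors R) Finset.univ
    fun i => (c i : F)
  -- An invariant common denominator keeps the cleared coefficients invariant.
  obtain ⟨n, d, hn, hnd⟩ := exists_fixed_multiple G (nonZeroDivisors.ne_zero b.2)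
  have hex : ∀ i, ∃ y : R, algebraMap R F y = algebraMap R F n * c i := by
    intro i
    obtain ⟨y, hy⟩ := hb i (Finset.mem_univ i)
    refine ⟨d * y, ?_⟩
    rw [map_mul, hy, hnd, map_mul, mul_assoc, Algebra.smul_def]
  choose y hy using hex
  have hyfix : ∀ i (g : G), g • y i = y i := by
    intro i g
    apply hinj
    rw [hsm, hy, smul_mul', ← hsm, smul_coe_fixed]
    congr 1
    exact (c i).2 g
  refine ⟨fun i => ⟨y i, hyfix i⟩, fun h => hj ?_, hinj ?_⟩
  · have h0 : y j = 0 := congrArg Subtype.val (congrFun h j)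
    have h1 := hy j
    rw [h0, map_zero, eq_comm, mul_eq_zero] at h1
    rcases h1 with h1 | h1
    · exact absurd (Subtype.ext (hinj (h1.trans (map_zero _).symm))) hn
    · exact Subtype.ext h1
  · rw [map_zero, map_sum, ← mul_zero (algebraMap R F n), ← hc, Finset.mul_sum]
    refine Finset.sum_congr rfl fun i _ => ?_
    rw [map_mul, hy, mul_assoc]
    rfl

/-- A linear relation over the invariants of a Dedekind domain can be chosen to be nontrivial
modulo a given prime. -/
theorem exists_fixed_relation_notMem [IsDedekindDomain R] {κ : Type*} [Fintype κ]
    (hκ : Nat.card G < Fintype.card κ) (x : κ → R) (p : Ideal (FixedPoints.subring R G))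
    [p.IsPrime] :
    ∃ b : κ → FixedPoints.subring R G, (∃ j, b j ∉ p) ∧ ∑ i, (b i : R) * x i = 0 := by
  obtain ⟨a, ha, hax⟩ := exists_fixed_relation hκ x
  have hint : Algebra.IsIntegral (FixedPoints.subring R G) R := Algebra.IsInvariant.isIntegral _ _ G
  obtain ⟨q, -, hq, hqp⟩ := Ideal.exists_ideal_over_prime_of_isIntegral (S := R) p ⊥ (by
    intro r hr
    have : r = 0 := Subtype.ext hr
    rw [this]
    exact p.zero_mem)
  let J : Ideal R := Ideal.span (Set.range fun i => (a i : R))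
  have haJ : ∀ i, (a i : R) ∈ J := fun i => Ideal.subset_span ⟨i, rfl⟩
  have hJ : J ≠ ⊥ := by
    intro h
    refine ha (funext fun i => Subtype.ext ?_)
    have := haJ i
    rwa [h, Ideal.mem_bot] at this
  -- Otherwise `J = J q`, and cancelling the nonzero ideal `J` gives `q = R`. This `a j` plays the
  -- role of a coefficient of least valuation at `q`.
  obtain ⟨j, hj⟩ : ∃ j, (a j : R) ∉ J * q := by
    by_contra! h
    have hle : J ≤ J * q := Ideal.span_le.2 (by rintro _ ⟨i, rfl⟩; exact h i)
    have : J * q = J * 1 := by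
      rw [mul_one]
      exact le_antisymm Ideal.mul_le_left hle
    exact hq.ne_top ((mul_left_cancel₀ hJ this).trans Ideal.one_eq_top)
  -- The ideal of multipliers `t` for which every `t a_i / a_j` lies in `R`. It is `G`-stable
  -- because the `a_i` are invariant.
  let D : Ideal R :=
    { carrier := {t | ∀ i, (a j : R) ∣ t * a i}
      add_mem' := fun hs ht i => by rw [add_mul]; exact dvd_add (hs i) (ht i)
      zero_mem' := fun i => by rw [zero_mul]; exact dvd_zero _
      smul_mem' := fun c t ht i => by
        rw [smul_eq_mul, mul_assoc]; exact dvd_mul_of_dvd_right (ht i) c }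
  have hDinv : ∀ (g : G) (t : R), t ∈ D → g • t ∈ D := by
    intro g t ht i
    obtain ⟨c, hc⟩ := ht i
    refine ⟨g • c, ?_⟩
    have := congrArg (g • ·) hc
    simpa only [smul_mul', smul_coe_fixed] using this
  have hDq : ¬ D ≤ q := by
    intro hDq
    have hle : Ideal.span {(a j : R)} ≤ J := (Ideal.span_singleton_le_iff_mem _).2 (haJ j)
    obtain ⟨E, hE⟩ := Ideal.dvd_iff_le.2 hle
    have hED : E ≤ D := by
      intro t ht i
      have : t * a i ∈ Ideal.span {(a j : R)} := by
        rw [hE, mul_comm J]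
        exact Ideal.mul_mem_mul ht (haJ i)
      exact Ideal.mem_span_singleton.1 this
    apply hj
    have h1 : (a j : R) ∈ J * E := hE ▸ Ideal.mem_span_singleton_self _
    exact Ideal.mul_mono_right (hED.trans hDq) h1
  -- Otherwise a prime over `p` contains `D`; it is conjugate to `q`, so `q` contains the `G`-stable
  -- ideal `D` too.
  have hDp : ¬ D.comap (algebraMap (FixedPoints.subring R G) R) ≤ p := by
    intro hDp
    obtain ⟨q', hDq', hq', hqp'⟩ := Ideal.exists_ideal_over_prime_of_isIntegral (S := R) p D hDp
    obtain ⟨g, hg⟩ := Algebra.IsInvariant.exists_smul_of_under_eq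
      (FixedPoints.subring R G) R G q q' (hqp.trans hqp'.symm)
    refine hDq fun t ht => ?_
    have h1 := hDq' (hDinv g t ht)
    rw [hg] at h1
    exact Ideal.smul_mem_pointwise_smul_iff.1 h1
  obtain ⟨t, htD, htp⟩ := Set.not_subset.1 hDp
  have hj0 : (a j : R) ≠ 0 := fun h => hj (h ▸ Ideal.zero_mem _)
  -- The new coefficients are `b_i = t a_i / a_j`, so that `b_j = t ∉ p`.
  choose b hb using (show ∀ i, (a j : R) ∣ (t : R) * a i from htD)
  have hbfix : ∀ i (g : G), g • b i = b i := by
    intro i g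
    have := congrArg (g • ·) (hb i)
    simp only [smul_mul', smul_coe_fixed] at this
    exact mul_left_cancel₀ hj0 (this.symm.trans (hb i))
  refine ⟨fun i => ⟨b i, hbfix i⟩, ⟨j, ?_⟩, ?_⟩
  · have : (⟨b j, hbfix j⟩ : FixedPoints.subring R G) = t := by
      apply Subtype.ext
      apply mul_left_cancel₀ hj0
      rw [mul_comm _ (t : R)]
      exact (hb j).symm
    exact fun h => htp (this ▸ h)
  · apply mul_left_cancel₀ hj0
    rw [mul_zero, Finset.mul_sum]
    calc ∑ i, (a j : R) * (b i * x i) = ∑ i, (t : R) * (a i * x i) :=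
          Finset.sum_congr rfl fun i _ => by rw [← mul_assoc, ← hb, mul_assoc]
      _ = 0 := by rw [← Finset.mul_sum, hax, mul_zero]

/-- The quotient of a Dedekind domain by an ideal that meets the ring of invariants in a maximal
ideal is finite over the invariants. -/
theorem finite_quotient_over_fixed [IsDedekindDomain R] (p : Ideal (FixedPoints.subring R G))
    [p.IsMaximal] (I : Ideal R) (hp : p = I.comap (algebraMap (FixedPoints.subring R G) R)) :
    Module.Finite (FixedPoints.subring R G) (R ⧸ I) := by
  let := Ideal.Quotient.field p
  let : Algebra (FixedPoints.subring R G ⧸ p) (R ⧸ I) :=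
    Ideal.Quotient.algebraQuotientOfLEComap hp.le
  have : IsScalarTower (FixedPoints.subring R G) (FixedPoints.subring R G ⧸ p) (R ⧸ I) :=
    IsScalarTower.of_algebraMap_eq fun _ => rfl
  have hrank : Module.rank (FixedPoints.subring R G ⧸ p) (R ⧸ I) ≤ (Nat.card G : Cardinal) := by
    refine rank_le fun s hs => ?_
    by_contra! hcard
    obtain ⟨b, ⟨j, hj⟩, hb⟩ := exists_fixed_relation_notMem (G := G) (κ := s)
      (by rwa [Fintype.card_coe]) (fun i => Quotient.out (i : R ⧸ I)) p
    refine hj (Ideal.Quotient.eq_zero_iff_mem.1 ?_)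
    refine Fintype.linearIndependent_iff.1 hs (fun i => Ideal.Quotient.mk p (b i)) ?_ j
    have := congrArg (Ideal.Quotient.mk I) hb
    rw [map_sum, map_zero] at this
    rw [← this]
    refine Finset.sum_congr rfl fun i _ => ?_
    rw [map_mul, Ideal.Quotient.mk_out, Algebra.smul_def]
    rfl
  have : Module.Finite (FixedPoints.subring R G ⧸ p) (R ⧸ I) :=
    Module.rank_lt_aleph0_iff.1 (hrank.trans_lt Cardinal.natCast_lt_aleph0)
  exact Module.Finite.trans (FixedPoints.subring R G ⧸ p) _

/-- Nonzero primes of the ring of invariants of a Dedekind domain are maximal. -/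
theorem isMaximal_of_isPrime_fixed [IsDedekindDomain R] (p : Ideal (FixedPoints.subring R G))
    [hp : p.IsPrime] (h0 : p ≠ ⊥) : p.IsMaximal := by
  have hint : Algebra.IsIntegral (FixedPoints.subring R G) R := Algebra.IsInvariant.isIntegral _ _ G
  obtain ⟨q, -, hq, rfl⟩ := Ideal.exists_ideal_over_prime_of_isIntegral (S := R) p ⊥ (by
    intro r hr
    have : r = 0 := Subtype.ext hr
    rw [this]
    exact p.zero_mem)
  have hq0 : q ≠ ⊥ := by
    rintro rfl
    exact h0 (le_bot_iff.1 fun r hr => Subtype.ext hr)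
  have := hq.isMaximal hq0
  exact Ideal.isMaximal_comap_of_isIntegral_of_isMaximal q

end FixedRing

/-! ### Graded Artinian rings: gr-prime implies gr-simple -/

section Grading

variable {G Q : Type*} [Group G] [Fintype G] [Ring Q]

/-- A decomposition of the ring `Q` into homogeneous parts `𝒜 g`, the projections being `π g`. -/
structure IsGrading (𝒜 : G → AddSubgroup Q) (π : G → Q →+ Q) : Prop where
  one_mem : 1 ∈ 𝒜 1
  mul_mem : ∀ g h, ∀ x ∈ 𝒜 g, ∀ y ∈ 𝒜 h, x * y ∈ 𝒜 (g * h)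
  proj_mem : ∀ g x, π g x ∈ 𝒜 g
  proj_self : ∀ g, ∀ x ∈ 𝒜 g, π g x = x
  proj_of_ne : ∀ g h, g ≠ h → ∀ x ∈ 𝒜 h, π g x = 0
  sum_proj : ∀ x, ∑ g, π g x = x

/-- A left ideal stable under the projections onto the homogeneous parts. -/
def IsHomogeneous (π : G → Q →+ Q) (I : Ideal Q) : Prop := ∀ x ∈ I, ∀ g, π g x ∈ I

namespace IsGrading

variable {𝒜 : G → AddSubgroup Q} {π : G → Q →+ Q} (H : IsGrading 𝒜 π)
include H

theorem proj_mul_right {h : G} {a : Q} (ha : a ∈ 𝒜 h) (g : G) (x : Q) :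
    π g (x * a) = π (g * h⁻¹) x * a := by
  classical
  conv_lhs => rw [← H.sum_proj x, Finset.sum_mul, map_sum]
  rw [Finset.sum_eq_single (g * h⁻¹)]
  · apply H.proj_self
    simpa using H.mul_mem _ _ _ (H.proj_mem (g * h⁻¹) x) _ ha
  · intro k _ hk
    refine H.proj_of_ne _ _ (fun h' => hk ?_) _ (H.mul_mem _ _ _ (H.proj_mem k x) _ ha)
    rw [h']; group
  · simp

theorem proj_mul_left {h : G} {a : Q} (ha : a ∈ 𝒜 h) (g : G) (x : Q) :
    π g (a * x) = a * π (h⁻¹ * g) x := by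
  classical
  conv_lhs => rw [← H.sum_proj x, Finset.mul_sum, map_sum]
  rw [Finset.sum_eq_single (h⁻¹ * g)]
  · apply H.proj_self
    simpa using H.mul_mem _ _ _ ha _ (H.proj_mem (h⁻¹ * g) x)
  · intro k _ hk
    refine H.proj_of_ne _ _ (fun h' => hk ?_) _ (H.mul_mem _ _ _ ha _ (H.proj_mem k x))
    rw [h']; group
  · simp

theorem mem_of_proj_mem {S : Type*} [SetLike S Q] [AddSubmonoidClass S Q]
    {M : S} {x : Q} (h : ∀ g, π g x ∈ M) : x ∈ M := by
  rw [← H.sum_proj x]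
  exact sum_mem fun g _ => h g

theorem exists_homogeneous_ne_zero {I : Ideal Q} (hI : IsHomogeneous π I) (h0 : I ≠ ⊥) :
    ∃ g, ∃ a ∈ 𝒜 g, a ∈ I ∧ a ≠ 0 := by
  by_contra! h
  refine h0 (le_bot_iff.1 fun x hx => ?_)
  refine H.mem_of_proj_mem fun g => ?_
  exact h g _ (H.proj_mem g x) (hI x hx g)

theorem isInternal [DecidableEq G] : DirectSum.IsInternal 𝒜 := by
  have key : ∀ (d : DirectSum G fun g => 𝒜 g) (g : G),
      π g (DirectSum.coeAddMonoidHom 𝒜 d) = d g := by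
    intro d g
    induction d using DirectSum.induction_on with
    | zero => simp
    | of h x =>
      rw [DirectSum.coeAddMonoidHom_of]
      by_cases hgh : g = h
      · subst hgh
        rw [H.proj_self _ _ x.2, DirectSum.of_eq_same]
      · rw [H.proj_of_ne _ _ hgh _ x.2, DirectSum.of_eq_of_ne _ _ _ hgh]
        rfl
    | add x y hx hy => rw [map_add, map_add, hx, hy]; rfl
  refine ⟨fun d e hde => ?_, fun x => ?_⟩
  · refine DFinsupp.ext fun g => Subtype.ext ?_
    rw [← key d g, ← key e g, hde]
  · refine ⟨∑ g, DirectSum.of (fun g => 𝒜 g) g ⟨π g x, H.proj_mem g x⟩, ?_⟩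
    rw [map_sum]
    simp only [DirectSum.coeAddMonoidHom_of]
    exact H.sum_proj x

/-- Right multiplication by a homogeneous element shifts degrees, so its kernel is graded. Such
intersections supply the smaller graded left ideals in the minimality arguments. -/
theorem isHomogeneous_inf_ker {h : G} {a : Q} (ha : a ∈ 𝒜 h) {I : Ideal Q}
    (hI : IsHomogeneous π I) :
    IsHomogeneous π (I ⊓ LinearMap.ker (LinearMap.toSpanSingleton Q Q a)) := by
  rintro x ⟨hxI, hxa⟩ g
  refine ⟨hI x hxI g, ?_⟩
  have hxa : x * a = 0 := hxa
  change π g x * a = 0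
  have := H.proj_mul_right ha (g * h) x
  rw [hxa, map_zero, mul_inv_cancel_right] at this
  exact this.symm

/-- A minimal graded left ideal of a gr-prime ring contains a nonzero idempotent of degree `1`. -/
theorem exists_idempotent
    (hprime : ∀ g h, ∀ a ∈ 𝒜 g, ∀ b ∈ 𝒜 h, (∀ x, a * x * b = 0) → a = 0 ∨ b = 0)
    {L : Ideal Q} (hL : IsHomogeneous π L) (h0 : L ≠ ⊥)
    (hmin : ∀ L' : Ideal Q, IsHomogeneous π L' → L' ≤ L → L' = ⊥ ∨ L' = L) :
    ∃ e ∈ 𝒜 1, e ∈ L ∧ e ≠ 0 ∧ e * e = e := by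
  obtain ⟨g, a, hag, haL, ha0⟩ := H.exists_homogeneous_ne_zero hL h0
  obtain ⟨h, y, hyh, hy⟩ : ∃ h, ∃ y ∈ 𝒜 h, a * y * a ≠ 0 := by
    by_contra! hcon
    refine ha0 ((hprime g g a hag a hag fun x => ?_).elim id id)
    rw [← H.sum_proj x, Finset.mul_sum, Finset.sum_mul]
    exact Finset.sum_eq_zero fun k _ => hcon k _ (H.proj_mem k x)
  -- Right multiplication by `z` does not kill `a ∈ L`, so by minimality it maps `L` onto `L` with
  -- zero kernel.
  set z := y * a with hz
  have hzL : z ∈ L := L.mul_mem_left y haL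
  have hzh : z ∈ 𝒜 (h * g) := H.mul_mem _ _ _ hyh _ hag
  have haz : a * z ≠ 0 := by rwa [hz, ← mul_assoc]
  have hz0 : z ≠ 0 := fun h => haz (by rw [h, mul_zero])
  have hmap : Submodule.map (LinearMap.toSpanSingleton Q Q z) L = L := by
    refine (hmin _ ?_ ?_).resolve_left ?_
    · rintro _ ⟨x, hx, rfl⟩ k
      refine ⟨_, hL x hx (k * (h * g)⁻¹), ?_⟩
      exact (H.proj_mul_right hzh k x).symm
    · rintro _ ⟨x, -, rfl⟩
      exact L.mul_mem_left x hzL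
    · intro hbot
      have : a * z ∈ Submodule.map (LinearMap.toSpanSingleton Q Q z) L := ⟨a, haL, rfl⟩
      rw [hbot] at this
      exact haz this
  have hker : L ⊓ LinearMap.ker (LinearMap.toSpanSingleton Q Q z) = ⊥ := by
    refine (hmin _ (H.isHomogeneous_inf_ker hzh hL) inf_le_left).resolve_right fun h => haz ?_
    have : a ∈ L ⊓ LinearMap.ker (LinearMap.toSpanSingleton Q Q z) := h.symm ▸ haL
    exact this.2
  obtain ⟨f, hfL, hfz⟩ : z ∈ Submodule.map (LinearMap.toSpanSingleton Q Q z) L := hmap.symm ▸ hzL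
  have hfz : f * z = z := hfz
  -- Comparing degrees in `f z = z` replaces `f` by its part of degree `1`; injectivity of
  -- multiplication by `z` then makes this part idempotent.
  have hez : π 1 f * z = z := by
    have := H.proj_mul_right hzh (h * g) f
    rw [hfz, mul_inv_cancel, H.proj_self _ _ hzh] at this
    exact this.symm
  refine ⟨π 1 f, H.proj_mem 1 f, hL f hfL 1, fun h => hz0 ?_, sub_eq_zero.1 ?_⟩
  · rw [← hez, h, zero_mul]
  · have : π 1 f * π 1 f - π 1 f ∈ L ⊓ LinearMap.ker (LinearMap.toSpanSingleton Q Q z) := by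
      refine ⟨L.sub_mem (L.mul_mem_left _ (hL f hfL 1)) (hL f hfL 1), ?_⟩
      change (π 1 f * π 1 f - π 1 f) * z = 0
      rw [sub_mul, mul_assoc, hez, hez, sub_self]
    rwa [hker] at this

/-- A left Artinian gr-prime ring is gr-simple. -/
theorem eq_top_of_ne_bot [IsArtinianRing Q]
    (hprime : ∀ g h, ∀ a ∈ 𝒜 g, ∀ b ∈ 𝒜 h, (∀ x, a * x * b = 0) → a = 0 ∨ b = 0)
    {I : Ideal Q} [I.IsTwoSided] (hI : IsHomogeneous π I) (h0 : I ≠ ⊥) : I = ⊤ := by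
  have hwf : WellFounded ((· < ·) : Ideal Q → Ideal Q → Prop) := wellFounded_lt
  -- A minimal graded left ideal `N` with `N + I = Q` will be shown to meet `I` in `0`, and then to
  -- vanish.
  obtain ⟨N, ⟨hN, hNI⟩, hNmin⟩ := hwf.has_min {N | IsHomogeneous π N ∧ N ⊔ I = ⊤}
    ⟨⊤, fun _ _ _ => trivial, top_sup_eq _⟩
  have hdisj : N ⊓ I = ⊥ := by
    by_contra hne
    have hNIhom : IsHomogeneous π (N ⊓ I) := fun x hx g => ⟨hN x hx.1 g, hI x hx.2 g⟩
    obtain ⟨L, ⟨hL, hLX, hL0⟩, hLmin⟩ :=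
      hwf.has_min {L | IsHomogeneous π L ∧ L ≤ N ⊓ I ∧ L ≠ ⊥} ⟨_, hNIhom, le_rfl, hne⟩
    obtain ⟨e, he1, heL, he0, hee⟩ := H.exists_idempotent hprime hL hL0 fun L' hL' hle => by
      by_contra! hcon
      exact hLmin L' ⟨hL', hle.trans hLX, hcon.1⟩ (lt_of_le_of_ne hle hcon.2)
    have heX := hLX heL
    -- Since `n = (n - n e) + n e` with `n e ∈ I`, the part of `N` killed by `e` still supplements
    -- `I`; it is smaller because `e * e ≠ 0`.
    refine hNmin _ ⟨H.isHomogeneous_inf_ker he1 hN, ?_⟩ (lt_of_le_of_ne inf_le_left fun h => ?_)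
    · rw [eq_top_iff, ← hNI]
      refine sup_le (fun n hn => ?_) le_sup_right
      rw [← sub_add_cancel n (n * e)]
      refine Submodule.add_mem_sup ⟨N.sub_mem hn (N.mul_mem_left n heX.1), ?_⟩
        (I.mul_mem_left n heX.2)
      change (n - n * e) * e = 0
      rw [sub_mul, mul_assoc, hee, sub_self]
    · have : e ∈ N ⊓ LinearMap.ker (LinearMap.toSpanSingleton Q Q e) := h.symm ▸ heX.1
      have h2 : e * e = 0 := this.2
      exact he0 (hee.symm.trans h2)
  have hNbot : N = ⊥ := by
    by_contra hN0
    obtain ⟨g, n, hng, hnN, hn0⟩ := H.exists_homogeneous_ne_zero hN hN0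
    obtain ⟨h, i, hih, hiI, hi0⟩ := H.exists_homogeneous_ne_zero hI h0
    -- As `I` is two-sided, `i Q n ⊆ N ∩ I = 0`.
    refine (hprime h g i hih n hng fun x => ?_).elim hi0 hn0
    have : i * x * n ∈ N ⊓ I :=
      ⟨N.mul_mem_left _ hnN, I.mul_mem_right _ (I.mul_mem_right _ hiI)⟩
    rwa [hdisj] at this
  rwa [hNbot, bot_sup_eq] at hNI

end IsGrading

end Grading

/-! ### Gradings on quotients and subrings -/

section Transfer

variable {G L Q : Type*} [Group G] [Fintype G] [Ring L] [Ring Q]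

/-- The map induced on a quotient by a map that preserves the kernel. -/
noncomputable def inducedMap (f : L →+* Q) (hf : Function.Surjective f) (φ : L →+ L)
    (hφ : ∀ x, f x = 0 → f (φ x) = 0) : Q →+ Q :=
  f.toAddMonoidHom.liftOfSurjective hf ⟨f.toAddMonoidHom.comp φ, hφ⟩

theorem inducedMap_apply (f : L →+* Q) (hf : Function.Surjective f) (φ : L →+ L)
    (hφ : ∀ x, f x = 0 → f (φ x) = 0) (x : L) : inducedMap f hf φ hφ (f x) = f (φ x) :=
  AddMonoidHom.liftOfRightInverse_comp_apply f.toAddMonoidHom _ _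
    ⟨f.toAddMonoidHom.comp φ, hφ⟩ x

theorem IsGrading.map {𝒜 : G → AddSubgroup L} {π : G → L →+ L} (H : IsGrading 𝒜 π)
    (f : L →+* Q) (hf : Function.Surjective f) (hker : ∀ g x, f x = 0 → f (π g x) = 0) :
    IsGrading (fun g => (𝒜 g).map f.toAddMonoidHom) fun g => inducedMap f hf (π g) (hker g) where
  one_mem := ⟨1, H.one_mem, map_one f⟩
  mul_mem := by
    rintro g h _ ⟨x, hx, rfl⟩ _ ⟨y, hy, rfl⟩
    exact ⟨x * y, H.mul_mem g h x hx y hy, map_mul f x y⟩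
  proj_mem g x := by
    obtain ⟨x, rfl⟩ := hf x
    rw [inducedMap_apply]
    exact ⟨_, H.proj_mem g x, rfl⟩
  proj_self := by
    rintro g _ ⟨x, hx, rfl⟩
    exact (inducedMap_apply _ _ _ _ x).trans (congrArg f (H.proj_self g x hx))
  proj_of_ne := by
    rintro g h hne _ ⟨x, hx, rfl⟩
    exact (inducedMap_apply _ _ _ _ x).trans
      ((congrArg f (H.proj_of_ne g h hne x hx)).trans (map_zero f))
  sum_proj x := by
    obtain ⟨x, rfl⟩ := hf x
    simp_rw [inducedMap_apply]
    rw [← map_sum, H.sum_proj]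

/-- The restriction of an additive endomorphism to a subring that it preserves. -/
def restrictHom (Λ : Subring L) (φ : L →+ L) (hφ : ∀ x ∈ Λ, φ x ∈ Λ) : Λ →+ Λ where
  toFun x := ⟨φ x, hφ x x.2⟩
  map_zero' := Subtype.ext (map_zero φ)
  map_add' x y := Subtype.ext (map_add φ (x : L) (y : L))

theorem IsGrading.restrict {𝒜 : G → AddSubgroup L} {π : G → L →+ L} (H : IsGrading 𝒜 π)
    (Λ : Subring L) (hΛ : ∀ g, ∀ x ∈ Λ, π g x ∈ Λ) :
    IsGrading (fun g => (𝒜 g).comap Λ.subtype.toAddMonoidHom)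
      fun g => restrictHom Λ (π g) (hΛ g) where
  one_mem := H.one_mem
  mul_mem g h x hx y hy := H.mul_mem g h x hx y hy
  proj_mem g x := H.proj_mem g x
  proj_self g x hx := Subtype.ext (H.proj_self g x hx)
  proj_of_ne g h hne x hx := Subtype.ext (H.proj_of_ne g h hne x hx)
  sum_proj x := Subtype.ext (by
    rw [AddSubmonoidClass.coe_finsetSum]
    exact H.sum_proj x)

end Transfer

/-! ### Coefficients and homogeneous parts in a crystalline graded ring -/

section Coefficients

variable {B A G : Type*} [Ring B] [Ring A] [Group G] {ι : B →+* A} {u : G → A}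

/-- The additive isomorphism between `A` and the free left module with basis `G`. -/
noncomputable def coeffEquiv (hA : IsCrystallineGraded ι u) : (G →₀ B) ≃+ A :=
  AddEquiv.ofBijective
    (Finsupp.liftAddHom fun g => (AddMonoidHom.mulRight (u g)).comp ι.toAddMonoidHom)
    hA.direct_sum

theorem coeffEquiv_apply (hA : IsCrystallineGraded ι u) (c : G →₀ B) :
    coeffEquiv hA c = c.sum fun g b => ι b * u g := rfl

/-- The coefficient of `u g`. -/
noncomputable def coeff (hA : IsCrystallineGraded ι u) (g : G) : A →+ B :=
  (Finsupp.applyAddHom g).comp (coeffEquiv hA).symm.toAddMonoidHom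

/-- The homogeneous part of degree `g`. -/
noncomputable def homogeneousPart (hA : IsCrystallineGraded ι u) (g : G) : A →+ A :=
  ((AddMonoidHom.mulRight (u g)).comp ι.toAddMonoidHom).comp (coeff hA g)

theorem homogeneousPart_apply (hA : IsCrystallineGraded ι u) (g : G) (x : A) :
    homogeneousPart hA g x = ι (coeff hA g x) * u g := rfl

theorem coeffEquiv_symm_mul (hA : IsCrystallineGraded ι u) (g : G) (b : B) :
    (coeffEquiv hA).symm (ι b * u g) = Finsupp.single g b := by
  rw [AddEquiv.symm_apply_eq, coeffEquiv_apply, Finsupp.sum_single_index]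
  rw [map_zero, zero_mul]

theorem coeff_mul_self (hA : IsCrystallineGraded ι u) (g : G) (b : B) :
    coeff hA g (ι b * u g) = b := by
  change (coeffEquiv hA).symm (ι b * u g) g = b
  rw [coeffEquiv_symm_mul, Finsupp.single_eq_same]

theorem coeff_mul_of_ne (hA : IsCrystallineGraded ι u) {g h : G} (hne : g ≠ h) (b : B) :
    coeff hA g (ι b * u h) = 0 := by
  change (coeffEquiv hA).symm (ι b * u h) g = 0
  rw [coeffEquiv_symm_mul, Finsupp.single_eq_of_ne hne]

theorem sum_coeff [Fintype G] (hA : IsCrystallineGraded ι u) (x : A) :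
    ∑ g, ι (coeff hA g x) * u g = x := by
  conv_rhs => rw [← (coeffEquiv hA).apply_symm_apply x, coeffEquiv_apply]
  rw [Finsupp.sum_fintype]
  · rfl
  · intro g
    rw [map_zero, zero_mul]

theorem isGrading_component [Fintype G] (hA : IsCrystallineGraded ι u) :
    IsGrading (component ι u) (homogeneousPart hA) where
  one_mem := ⟨1, by
    change ι 1 * u 1 = 1
    rw [map_one, hA.u_one, mul_one]⟩
  mul_mem := by
    rintro g h _ ⟨b, rfl⟩ _ ⟨c, rfl⟩
    obtain ⟨d, hd⟩ := hA.graded g h b c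
    exact ⟨d, hd.symm⟩
  proj_mem g x := ⟨coeff hA g x, rfl⟩
  proj_self := by
    rintro g _ ⟨b, rfl⟩
    change ι (coeff hA g (ι b * u g)) * u g = ι b * u g
    rw [coeff_mul_self]
  proj_of_ne := by
    rintro g h hne _ ⟨b, rfl⟩
    change ι (coeff hA g (ι b * u h)) * u g = 0
    rw [coeff_mul_of_ne hA hne, map_zero, zero_mul]
  sum_proj x := sum_coeff hA x

theorem isGradedSet_iff (hA : IsCrystallineGraded ι u) (T : Set A) :
    IsGradedSet ι u T ↔ ∀ x ∈ T, ∀ g, homogeneousPart hA g x ∈ T := by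
  constructor
  · intro h x hx g
    refine h ((coeffEquiv hA).symm x) ?_ g
    rwa [← coeffEquiv_apply hA, AddEquiv.apply_symm_apply]
  · intro h c hc g
    have := h _ hc g
    rw [← coeffEquiv_apply hA, homogeneousPart_apply] at this
    change ι ((coeffEquiv hA).symm (coeffEquiv hA c) g) * u g ∈ T at this
    rwa [AddEquiv.symm_apply_apply] at this

end Coefficients

/-! ### Finite generation of submodules over a Noetherian ring -/

section FinitelyGenerated

variable {R A : Type*} [CommRing R] [AddCommGroup A] [Module R A]

/-- Translates the finite generation in `IsLattice` into spans, where Noetherian arguments apply. -/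
theorem closure_smul_eq_span (s : Set A) :
    AddSubgroup.closure {y | ∃ r : R, ∃ x ∈ s, y = r • x} = (Submodule.span R s).toAddSubgroup := by
  apply le_antisymm
  · rw [AddSubgroup.closure_le]
    rintro _ ⟨r, x, hx, rfl⟩
    exact Submodule.smul_mem _ r (Submodule.subset_span hx)
  · intro x hx
    replace hx : x ∈ Submodule.span R s := hx
    induction hx using Submodule.span_induction with
    | mem x hx => exact AddSubgroup.subset_closure ⟨1, x, hx, (one_smul R x).symm⟩
    | zero => exact zero_mem _
    | add x y _ _ hx hy => exact add_mem hx hy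
    | smul r x hspan hx =>
      clear hspan
      induction hx using AddSubgroup.closure_induction with
      | mem y hy =>
        obtain ⟨t, z, hz, rfl⟩ := hy
        exact AddSubgroup.subset_closure ⟨r * t, z, hz, smul_smul r t z⟩
      | zero => rw [smul_zero]; exact zero_mem _
      | add x y _ _ hx hy => rw [smul_add]; exact add_mem hx hy
      | neg x _ hx => rw [smul_neg]; exact neg_mem hx

theorem exists_finset_closure_of_le [IsNoetherianRing R] {M N : AddSubgroup A} (hMN : M ≤ N)
    (hM : ∀ r : R, ∀ x ∈ M, r • x ∈ M)
    (hN : ∃ s : Finset A, N = AddSubgroup.closure {y | ∃ r : R, ∃ x ∈ s, y = r • x}) :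
    ∃ s : Finset A, M = AddSubgroup.closure {y | ∃ r : R, ∃ x ∈ s, y = r • x} := by
  obtain ⟨s, rfl⟩ := hN
  let M' : Submodule R A := { M with smul_mem' := hM }
  have hle : M' ≤ Submodule.span R (s : Set A) := fun x hx =>
    (closure_smul_eq_span (R := R) (s : Set A)).le (hMN hx)
  have hnoeth := isNoetherian_of_fg_of_noetherian _ (Submodule.fg_span (R := R) s.finite_toSet)
  obtain ⟨t, ht⟩ := isNoetherian_submodule.1 hnoeth M' hle
  refine ⟨t, ?_⟩
  have := closure_smul_eq_span (R := R) (t : Set A)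
  rw [ht] at this
  exact this.symm

end FinitelyGenerated

/-! ### Graded orders and their graded Ideals -/

section Orders

variable {R K A G : Type*} [CommRing R] [Field K] [Algebra R K] [Ring A] {ι : K →+* A}

theorem baseHom_apply (r : R) : baseHom R ι r = ι (algebraMap R K r) := rfl

theorem mem_inAmbient {Λ : Subring A} {P : Ideal Λ} {x : A} :
    x ∈ inAmbient P ↔ ∃ h : x ∈ Λ, (⟨x, h⟩ : Λ) ∈ P := by
  constructor
  · rintro ⟨y, hy, rfl⟩
    exact ⟨y.2, hy⟩
  · rintro ⟨h, hx⟩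
    exact ⟨⟨x, h⟩, hx, rfl⟩

variable (R ι) in
/-- `A` as a left `R`-module. -/
abbrev leftModule : Module R A := Module.compHom A (baseHom R ι)

variable (R ι) in
/-- `A` as a right `R`-module. -/
abbrev rightModule : Module R A :=
  Module.compHom A ((baseHom R ι).toOpposite fun x y => (Commute.all x y).map (baseHom R ι))

/-- Torsion-freeness and, as `R` is Noetherian, finite generation descend from `N`; fullness ascends
from `M`. -/
theorem IsFullLattice.of_le [IsNoetherianRing R] {M M' N : AddSubgroup A}
    (hN : IsFullLattice R ι N) (hM : IsFullLattice R ι M) (hMM' : M ≤ M') (hM'N : M' ≤ N)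
    (hl : ∀ r : R, ∀ x ∈ M', baseHom R ι r * x ∈ M')
    (hr : ∀ r : R, ∀ x ∈ M', x * baseHom R ι r ∈ M') : IsFullLattice R ι M' where
  left_mem := hl
  right_mem := hr
  left_torsion_free r x hx := hN.left_torsion_free r x (hM'N hx)
  right_torsion_free r x hx := hN.right_torsion_free r x (hM'N hx)
  left_fg := by
    let _ := leftModule R ι
    exact exists_finset_closure_of_le (R := R) hM'N hl hN.left_fg
  right_fg := by
    let _ := rightModule R ι
    exact exists_finset_closure_of_le (R := R) hM'N hr hN.right_fg
  left_full := by
    rw [eq_top_iff, ← hM.left_full]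
    refine AddSubgroup.closure_mono ?_
    rintro _ ⟨k, x, hx, rfl⟩
    exact ⟨k, x, hMM' hx, rfl⟩
  right_full := by
    rw [eq_top_iff, ← hM.right_full]
    refine AddSubgroup.closure_mono ?_
    rintro _ ⟨k, x, hx, rfl⟩
    exact ⟨k, x, hMM' hx, rfl⟩

variable {u : G → A} {Λ : Subring A}

/-- The part of an order contained in `K` is `R`. -/
theorem IsGradedOrder.exists_algebraMap_eq [IsDedekindDomain R] [IsFractionRing R K]
    (hι : Function.Injective ι) (hΛ : IsGradedOrder R ι u Λ) {k : K} (hk : ι k ∈ Λ) :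
    ∃ r : R, algebraMap R K r = k := by
  -- `Λ ∩ K` is a subring inside a finitely generated `R`-module, hence integral over the integrally
  -- closed `R`.
  let S : Subalgebra R K :=
    { Λ.comap ι with algebraMap_mem' := fun r => hΛ.baseHom_mem R r }
  let _ := leftModule R ι
  let f : K →ₗ[R] A :=
    { ι.toAddMonoidHom with
      map_smul' := fun r x => by
        change ι (r • x) = baseHom R ι r * ι x
        rw [Algebra.smul_def, map_mul, baseHom_apply] }
  obtain ⟨s, hs⟩ := hΛ.full.left_fg
  have hnoeth := isNoetherian_of_fg_of_noetherian _ (Submodule.fg_span (R := R) s.finite_toSet)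
  have hle : S.toSubmodule.map f ≤ Submodule.span R (s : Set A) := by
    rintro _ ⟨x, hx, rfl⟩
    have h1 : ι x ∈ Λ.toAddSubgroup := hx
    rw [hs] at h1
    exact (closure_smul_eq_span (R := R) (s : Set A)).le h1
  have hfg : S.toSubmodule.FG :=
    Submodule.fg_of_fg_map_injective f hι (isNoetherian_submodule.1 hnoeth _ hle)
  exact IsIntegrallyClosed.isIntegral_iff.1 (IsIntegral.of_mem_of_fg S hfg k hk)

variable [Group G]

theorem IsGradedOrder.homogeneousPart_mem (hA : IsCrystallineGraded ι u)
    (hΛ : IsGradedOrder R ι u Λ) (g : G) (x : A) (hx : x ∈ Λ) : homogeneousPart hA g x ∈ Λ :=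
  (isGradedSet_iff hA _).1 hΛ.graded x hx g

/-- The homogeneous part of degree `g` of an element of a graded order. -/
noncomputable def orderPart (hA : IsCrystallineGraded ι u)
    (hΛ : IsGradedOrder R ι u Λ) (g : G) : Λ →+ Λ :=
  restrictHom Λ (homogeneousPart hA g) (hΛ.homogeneousPart_mem hA g)

theorem isGrading_order [Fintype G] (hA : IsCrystallineGraded ι u) (hΛ : IsGradedOrder R ι u Λ) :
    IsGrading (fun g => (component ι u g).comap Λ.subtype.toAddMonoidHom) (orderPart hA hΛ) :=
  (isGrading_component hA).restrict Λ (hΛ.homogeneousPart_mem hA)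

theorem isGradedSet_inAmbient_iff [Fintype G] (hA : IsCrystallineGraded ι u)
    (hΛ : IsGradedOrder R ι u Λ) (P : Ideal Λ) :
    IsGradedSet ι u (inAmbient P : Set A) ↔ IsHomogeneous (orderPart hA hΛ) P := by
  rw [isGradedSet_iff hA]
  constructor
  · intro h x hx g
    obtain ⟨_, h2⟩ := mem_inAmbient.1 (h x (mem_inAmbient.2 ⟨x.2, hx⟩) g)
    exact h2
  · intro h x hx g
    obtain ⟨hxΛ, hxP⟩ := mem_inAmbient.1 hx
    exact mem_inAmbient.2 ⟨_, h _ hxP g⟩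

theorem isGrIdeal_of_le [IsNoetherianRing R] [Fintype G] (hA : IsCrystallineGraded ι u)
    (hΛ : IsGradedOrder R ι u Λ) {P S : Ideal Λ} (hP : IsGrIdeal R ι u P) (hPS : P ≤ S)
    (hS : S.IsTwoSided) (hSh : IsHomogeneous (orderPart hA hΛ) S) : IsGrIdeal R ι u S where
  two_sided := hS
  graded := (isGradedSet_inAmbient_iff hA hΛ S).2 hSh
  full := by
    refine hΛ.full.of_le hP.full (fun x hx => ?_) (fun x hx => ?_) (fun r x hx => ?_)
      (fun r x hx => ?_)
    · obtain ⟨h1, h2⟩ := mem_inAmbient.1 hx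
      exact mem_inAmbient.2 ⟨h1, hPS h2⟩
    · exact (mem_inAmbient.1 hx).1
    · obtain ⟨h1, h2⟩ := mem_inAmbient.1 hx
      exact mem_inAmbient.2 ⟨_, S.mul_mem_left ⟨_, hΛ.baseHom_mem R r⟩ h2⟩
    · obtain ⟨h1, h2⟩ := mem_inAmbient.1 hx
      exact mem_inAmbient.2 ⟨_, S.mul_mem_right ⟨_, hΛ.baseHom_mem R r⟩ h2⟩

/-- If the coefficient of `u 1` vanished on `P`, it would vanish on `K P = A`, which contains `1`.
Gradedness then puts a nonzero element of `Λ ∩ K = R` in `P`. -/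
theorem IsGrIdeal.exists_baseHom_mem [IsDedekindDomain R] [IsFractionRing R K] [Fintype G]
    (hA : IsCrystallineGraded ι u) (hΛ : IsGradedOrder R ι u Λ) {P : Ideal Λ}
    (hP : IsGrIdeal R ι u P) : ∃ r : R, r ≠ 0 ∧ baseHom R ι r ∈ inAmbient P := by
  obtain ⟨x, hxP, hx⟩ : ∃ x ∈ inAmbient P, coeff hA 1 x ≠ 0 := by
    by_contra! h
    have hle : (⊤ : AddSubgroup A) ≤ (coeff hA 1).ker := by
      rw [← hP.full.left_full, AddSubgroup.closure_le]
      rintro _ ⟨k, x, hx, rfl⟩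
      have hx0 := h x hx
      rw [SetLike.mem_coe, AddMonoidHom.mem_ker]
      conv_lhs => rw [← sum_coeff hA x, Finset.mul_sum, map_sum]
      refine Finset.sum_eq_zero fun g _ => ?_
      rw [← mul_assoc, ← map_mul]
      by_cases hg : 1 = g
      · subst hg
        rw [coeff_mul_self, hx0, mul_zero]
      · exact coeff_mul_of_ne hA hg _
    have h1 : coeff hA 1 (ι 1 * u 1) = 0 := hle (AddSubgroup.mem_top _)
    rw [coeff_mul_self] at h1
    exact one_ne_zero h1
  have hmem := (isGradedSet_iff hA _).1 hP.graded x hxP 1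
  rw [homogeneousPart_apply, hA.u_one, mul_one] at hmem
  obtain ⟨r, hr⟩ := hΛ.exists_algebraMap_eq hA.ι_injective (mem_inAmbient.1 hmem).1
  refine ⟨r, fun h => hx ?_, ?_⟩
  · rw [← hr, h, map_zero]
  · rwa [baseHom_apply, hr]

end Orders

/-! ### Residual ideals -/

section Residuals

variable {L : Type*} [Ring L]

/-- The ideal of all `s` with `s W ⊆ P`. -/
def leftResidual (P W : Ideal L) : Ideal L where
  carrier := {s | ∀ w ∈ W, s * w ∈ P}
  zero_mem' w _ := by rw [zero_mul]; exact P.zero_mem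
  add_mem' hs ht w hw := by rw [add_mul]; exact P.add_mem (hs w hw) (ht w hw)
  smul_mem' c s hs w hw := by rw [smul_eq_mul, mul_assoc]; exact P.mul_mem_left c (hs w hw)

theorem leftResidual_isTwoSided (P W : Ideal L) : (leftResidual P W).IsTwoSided :=
  ⟨fun {s} y hs w hw => by rw [mul_assoc]; exact hs _ (W.mul_mem_left y hw)⟩

/-- The ideal of all `t` with `S t ⊆ P`. -/
def rightResidual (P S : Ideal L) [S.IsTwoSided] : Ideal L where
  carrier := {t | ∀ s ∈ S, s * t ∈ P}
  zero_mem' s _ := by rw [mul_zero]; exact P.zero_mem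
  add_mem' ht ht' s hs := by rw [mul_add]; exact P.add_mem (ht s hs) (ht' s hs)
  smul_mem' c t ht s hs := by
    rw [smul_eq_mul, ← mul_assoc]; exact ht _ (S.mul_mem_right c hs)

theorem rightResidual_isTwoSided (P S : Ideal L) [P.IsTwoSided] [S.IsTwoSided] :
    (rightResidual P S).IsTwoSided :=
  ⟨fun {t} y ht s hs => by rw [← mul_assoc]; exact P.mul_mem_right y (ht s hs)⟩

variable {G : Type*} [Group G] [Fintype G] {𝒜 : G → AddSubgroup L} {π : G → L →+ L}

/-- It suffices to test on homogeneous `w`, and then `s_g w` is a homogeneous part of `s w ∈ P`. -/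
theorem IsGrading.isHomogeneous_leftResidual (H : IsGrading 𝒜 π) {P W : Ideal L}
    (hP : IsHomogeneous π P) (hW : IsHomogeneous π W) : IsHomogeneous π (leftResidual P W) := by
  intro s hs g w hw
  rw [← H.sum_proj w, Finset.mul_sum]
  refine P.sum_mem fun h _ => ?_
  have := hP _ (hs _ (hW w hw h)) (g * h)
  rwa [H.proj_mul_right (H.proj_mem h w), mul_inv_cancel_right] at this

theorem IsGrading.isHomogeneous_rightResidual (H : IsGrading 𝒜 π) {P S : Ideal L}
    [S.IsTwoSided] (hP : IsHomogeneous π P) (hS : IsHomogeneous π S) :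
    IsHomogeneous π (rightResidual P S) := by
  intro t ht g s hs
  rw [← H.sum_proj s, Finset.sum_mul]
  refine P.sum_mem fun h _ => ?_
  have := hP _ (ht _ (hS s hs h)) (h * g)
  rwa [H.proj_mul_left (H.proj_mem h s), inv_mul_cancel_left] at this

end Residuals

/-! ### Gr-prime Ideals, central invariants and the quotient -/

section Primes

variable {R K A G : Type*} [CommRing R] [Field K] [Algebra R K] [Ring A] [Group G]
  {ι : K →+* A} {u : G → A} {Λ : Subring A}

theorem baseHom_mem_component_one (hA : IsCrystallineGraded ι u) (r : R) :
    baseHom R ι r ∈ component ι u 1 :=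
  ⟨algebraMap R K r, by
    change ι (algebraMap R K r) * u 1 = _
    rw [hA.u_one, mul_one, baseHom_apply]⟩

variable [Fintype G]

/-- The defining property of gr-prime Ideals, for homogeneous elements. -/
theorem IsGrPrime.mem_or_mem [IsNoetherianRing R] (hA : IsCrystallineGraded ι u)
    (hΛ : IsGradedOrder R ι u Λ) {P : Ideal Λ} (hP : IsGrPrime R ι u P) (a : Λ) {b : Λ} {h : G}
    (hb : (b : A) ∈ component ι u h) (hab : ∀ x, a * x * b ∈ P) : a ∈ P ∨ b ∈ P := by
  have H := isGrading_order hA hΛ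
  have := hP.gr_ideal.two_sided
  have hPh := (isGradedSet_inAmbient_iff hA hΛ P).1 hP.gr_ideal.graded
  have hW : IsHomogeneous (orderPart hA hΛ) (Ideal.span {b}) := by
    intro x hx g
    obtain ⟨y, rfl⟩ := Ideal.mem_span_singleton'.1 hx
    rw [H.proj_mul_right hb]
    exact Ideal.mul_mem_left _ _ (Ideal.mem_span_singleton_self b)
  -- The ideals generated by `a` and `b` need not be full lattices. The residuals `S ∋ a` and
  -- `rightResidual P S ∋ b` contain `P`, hence are, and their product lies in `P`.
  set S := leftResidual P (Ideal.span {b})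
  have hS2 : S.IsTwoSided := leftResidual_isTwoSided _ _
  have hSh : IsHomogeneous (orderPart hA hΛ) S := H.isHomogeneous_leftResidual hPh hW
  have hPS : P ≤ S := fun s hs w _ => P.mul_mem_right w hs
  have hPT : P ≤ rightResidual P S := fun t ht s _ => P.mul_mem_left s ht
  have haS : a ∈ S := by
    intro w hw
    obtain ⟨y, rfl⟩ := Ideal.mem_span_singleton'.1 hw
    rw [← mul_assoc]
    exact hab y
  have hbT : b ∈ rightResidual P S := fun s hs => hs b (Ideal.mem_span_singleton_self b)
  refine (hP.prime S (rightResidual P S) (isGrIdeal_of_le hA hΛ hP.gr_ideal hPS hS2 hSh)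
    (isGrIdeal_of_le hA hΛ hP.gr_ideal hPT (rightResidual_isTwoSided P S)
      (H.isHomogeneous_rightResidual hPh hSh)) fun s hs t ht => ht s hs).imp (· haS) (· hbT)

theorem IsGrMaximal.isGrPrime [IsNoetherianRing R] (hA : IsCrystallineGraded ι u)
    (hΛ : IsGradedOrder R ι u Λ) {P : Ideal Λ} (hP : IsGrMaximal R ι u P) :
    IsGrPrime R ι u P where
  gr_ideal := hP.gr_ideal
  proper := hP.proper
  prime S T hS hT hST := by
    have := hP.gr_ideal.two_sided
    have hPle : P ≤ leftResidual P T := fun s hs w _ => P.mul_mem_right w hs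
    have hgr := isGrIdeal_of_le hA hΛ hP.gr_ideal hPle (leftResidual_isTwoSided P T)
      ((isGrading_order hA hΛ).isHomogeneous_leftResidual
        ((isGradedSet_inAmbient_iff hA hΛ P).1 hP.gr_ideal.graded)
        ((isGradedSet_inAmbient_iff hA hΛ T).1 hT.graded))
    by_cases htop : leftResidual P T = ⊤
    · right
      intro t ht
      have h1 : (1 : Λ) ∈ leftResidual P T := htop ▸ Submodule.mem_top
      simpa using h1 t ht
    · left
      have heq := hP.maximal _ hgr htop hPle
      intro s hs
      exact heq.le fun t ht => hST s hs t ht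

/-- An invariant passes each `u g` unchanged and commutes with the coefficients in `K`. -/
theorem fixed_central [MulSemiringAction G R] (hA : IsCrystallineGraded ι u)
    (hσ : ∀ (g : G) (r : R), u g * baseHom R ι r = baseHom R ι (g • r) * u g)
    (a : FixedPoints.subring R G) (x : A) : baseHom R ι a * x = x * baseHom R ι a := by
  rw [← sum_coeff hA x, Finset.mul_sum, Finset.sum_mul]
  refine Finset.sum_congr rfl fun g _ => ?_
  rw [mul_assoc _ (u g), hσ, smul_coe_fixed, ← mul_assoc, ← mul_assoc, baseHom_apply, ← map_mul,
    ← map_mul, mul_comm]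

theorem IsGrPrime.isPrime_comap_fixed [MulSemiringAction G R] [IsNoetherianRing R]
    (hA : IsCrystallineGraded ι u)
    (hσ : ∀ (g : G) (r : R), u g * baseHom R ι r = baseHom R ι (g • r) * u g)
    (hΛ : IsGradedOrder R ι u Λ) {P : Ideal Λ} (hP : IsGrPrime R ι u P) :
    (P.comap (fixedToOrder R (G := G) hΛ)).IsPrime := by
  constructor
  · intro h
    apply hP.proper
    rw [Ideal.eq_top_iff_one] at h ⊢
    simpa [Ideal.mem_comap] using h
  · intro a b hab
    refine hP.mem_or_mem hA hΛ (fixedToOrder R hΛ a) (b := fixedToOrder R hΛ b) (h := 1)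
      (baseHom_mem_component_one hA _) fun x => ?_
    have hcomm : fixedToOrder R hΛ a * x = x * fixedToOrder R hΛ a :=
      Subtype.ext (fixed_central hA hσ a x)
    rw [hcomm, mul_assoc, ← map_mul]
    exact P.mul_mem_left x hab

theorem IsGrIdeal.comap_fixed_ne_bot [MulSemiringAction G R] [IsDedekindDomain R]
    [IsFractionRing R K] (hA : IsCrystallineGraded ι u)
    (hΛ : IsGradedOrder R ι u Λ) {P : Ideal Λ} (hP : IsGrIdeal R ι u P) :
    P.comap (fixedToOrder R (G := G) hΛ) ≠ ⊥ := by
  obtain ⟨r, hr0, hr⟩ := hP.exists_baseHom_mem hA hΛ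
  obtain ⟨a, c, ha0, hac⟩ := exists_fixed_multiple G hr0
  intro hbot
  have h1 := hP.full.left_mem c _ hr
  rw [← map_mul, ← hac] at h1
  have h2 : a ∈ P.comap (fixedToOrder R hΛ) := (mem_inAmbient.1 h1).2
  rw [hbot] at h2
  exact ha0 h2

/-- `Λ ⧸ P` is a finite algebra over the quotient of the ring of invariants. -/
theorem exists_finite_algebra_quotient [MulSemiringAction G R] [IsDedekindDomain R]
    (hA : IsCrystallineGraded ι u)
    (hσ : ∀ (g : G) (r : R), u g * baseHom R ι r = baseHom R ι (g • r) * u g)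
    (hΛ : IsGradedOrder R ι u Λ) (P : Ideal Λ) [P.IsTwoSided]
    (p : Ideal (FixedPoints.subring R G)) [p.IsMaximal]
    (hp : p = P.comap (fixedToOrder R hΛ)) :
    ∃ _ : Algebra (FixedPoints.subring R G ⧸ p) (Λ ⧸ P),
      (∀ a : FixedPoints.subring R G,
        algebraMap (FixedPoints.subring R G ⧸ p) (Λ ⧸ P) (Ideal.Quotient.mk p a)
          = Ideal.Quotient.mk P (fixedToOrder R hΛ a)) ∧
      Module.Finite (FixedPoints.subring R G ⧸ p) (Λ ⧸ P) := by
  let base : R →+* Λ := (baseHom R ι).codRestrict Λ (hΛ.baseHom_mem R)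
  let f : FixedPoints.subring R G →+* Λ ⧸ P := (Ideal.Quotient.mk P).comp (fixedToOrder R hΛ)
  have hf : ∀ a (x : Λ ⧸ P), f a * x = x * f a := by
    intro a x
    obtain ⟨x, rfl⟩ := Ideal.Quotient.mk_surjective x
    have hcomm : fixedToOrder R hΛ a * x = x * fixedToOrder R hΛ a :=
      Subtype.ext (fixed_central hA hσ a x)
    change Ideal.Quotient.mk P _ * _ = _ * Ideal.Quotient.mk P _
    rw [← map_mul, hcomm, map_mul]
  let fbar : (FixedPoints.subring R G ⧸ p) →+* Λ ⧸ P := Ideal.Quotient.lift p f fun a ha =>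
    Ideal.Quotient.eq_zero_iff_mem.2 (by rw [hp] at ha; exact ha)
  let alg : Algebra (FixedPoints.subring R G ⧸ p) (Λ ⧸ P) := fbar.toAlgebra' fun a x => by
    obtain ⟨a, rfl⟩ := Ideal.Quotient.mk_surjective a
    exact hf a x
  refine ⟨alg, fun a => rfl, ?_⟩
  let algF : Algebra (FixedPoints.subring R G) (Λ ⧸ P) := f.toAlgebra' hf
  have htower : IsScalarTower (FixedPoints.subring R G) (FixedPoints.subring R G ⧸ p) (Λ ⧸ P) :=
    ⟨fun a b x => by
      obtain ⟨b, rfl⟩ := Ideal.Quotient.mk_surjective b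
      change f (a * b) * x = f a * (f b * x)
      rw [map_mul, mul_assoc]⟩
  suffices Module.Finite (FixedPoints.subring R G) (Λ ⧸ P) from
    Module.Finite.of_restrictScalars_finite (FixedPoints.subring R G) _ _
  -- `Λ / P` is a finite sum of images of `R / I`, one for each left `R`-generator of `Λ`.
  let I : Ideal R := P.comap base
  have hI : Module.Finite (FixedPoints.subring R G) (R ⧸ I) := finite_quotient_over_fixed p I hp
  let ψ : R ⧸ I →+* Λ ⧸ P := Ideal.Quotient.lift I ((Ideal.Quotient.mk P).comp base) fun a ha =>
    Ideal.Quotient.eq_zero_iff_mem.2 ha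
  let φ (x : Λ ⧸ P) : (R ⧸ I) →ₗ[FixedPoints.subring R G] (Λ ⧸ P) :=
    { toFun := fun r => ψ r * x
      map_add' := fun r t => by rw [map_add, add_mul]
      map_smul' := fun a r => by
        rw [Algebra.smul_def, map_mul, RingHom.id_apply, Algebra.smul_def, mul_assoc]
        rfl }
  obtain ⟨s, hs⟩ := hΛ.full.left_fg
  have hsΛ : ∀ x ∈ s, x ∈ Λ := by
    intro x hx
    have : x ∈ Λ.toAddSubgroup := by
      rw [hs]
      exact AddSubgroup.subset_closure ⟨1, x, hx, by rw [map_one, one_mul]⟩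
    exact this
  let V : Submodule (FixedPoints.subring R G) (Λ ⧸ P) :=
    ⨆ x ∈ (Finset.univ : Finset s),
      LinearMap.range (φ (Ideal.Quotient.mk P ⟨x, hsΛ x x.2⟩))
  have hV : V.FG := Submodule.fg_biSup _ _ fun x _ => Module.Finite.iff_fg.1 inferInstance
  refine ⟨?_⟩
  convert hV
  symm
  rw [eq_top_iff]
  rintro y -
  obtain ⟨⟨y, hy⟩, rfl⟩ := Ideal.Quotient.mk_surjective y
  have key : ∀ z ∈ Λ.toAddSubgroup, ∃ h : z ∈ Λ, Ideal.Quotient.mk P ⟨z, h⟩ ∈ V := by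
    intro z hz
    rw [hs] at hz
    induction hz using AddSubgroup.closure_induction with
    | mem z hz =>
      obtain ⟨r, x, hx, rfl⟩ := hz
      refine ⟨Λ.mul_mem (hΛ.baseHom_mem R r) (hsΛ x hx), ?_⟩
      exact Submodule.mem_iSup_of_mem ⟨x, hx⟩
        (Submodule.mem_iSup_of_mem (Finset.mem_univ _) ⟨Ideal.Quotient.mk I r, rfl⟩)
    | zero => exact ⟨Λ.zero_mem, V.zero_mem⟩
    | add z w _ _ hz hw =>
      obtain ⟨hz, hz'⟩ := hz
      obtain ⟨hw, hw'⟩ := hw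
      exact ⟨Λ.add_mem hz hw, V.add_mem hz' hw'⟩
    | neg z _ hz =>
      obtain ⟨hz, hz'⟩ := hz
      exact ⟨Λ.neg_mem hz, V.neg_mem hz'⟩
  exact (key y hy).2

theorem exists_isGrading_quotient (hA : IsCrystallineGraded ι u)
    (hΛ : IsGradedOrder R ι u Λ) {P : Ideal Λ} [P.IsTwoSided]
    (hP : IsHomogeneous (orderPart hA hΛ) P) :
    ∃ π : G → (Λ ⧸ P) →+ (Λ ⧸ P), IsGrading (quotientComponent ι u P) π ∧
      ∀ g x, π g (Ideal.Quotient.mk P x) = Ideal.Quotient.mk P (orderPart hA hΛ g x) := by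
  have hker : ∀ g x, Ideal.Quotient.mk P x = 0 →
      Ideal.Quotient.mk P (orderPart hA hΛ g x) = 0 := fun g x hx =>
    Ideal.Quotient.eq_zero_iff_mem.2 (hP x (Ideal.Quotient.eq_zero_iff_mem.1 hx) g)
  exact ⟨_, (isGrading_order hA hΛ).map _ Ideal.Quotient.mk_surjective hker,
    fun g x => inducedMap_apply _ _ _ _ x⟩

/-- The homogeneous two-sided ideals of the quotient by a gr-prime Ideal are trivial. -/
theorem IsGrPrime.quotient_simple [MulSemiringAction G R] [IsDedekindDomain R]
    [IsFractionRing R K] (hA : IsCrystallineGraded ι u)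
    (hσ : ∀ (g : G) (r : R), u g * baseHom R ι r = baseHom R ι (g • r) * u g)
    (hΛ : IsGradedOrder R ι u Λ) {P : Ideal Λ} [P.IsTwoSided] (hP : IsGrPrime R ι u P)
    {π : G → (Λ ⧸ P) →+ (Λ ⧸ P)} (H : IsGrading (quotientComponent ι u P) π)
    {J : Ideal (Λ ⧸ P)} [J.IsTwoSided] (hJ : IsHomogeneous π J) (h0 : J ≠ ⊥) : J = ⊤ := by
  let p := P.comap (fixedToOrder R (G := G) hΛ)
  have hp : p.IsPrime := hP.isPrime_comap_fixed hA hσ hΛ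
  have hpm : p.IsMaximal := isMaximal_of_isPrime_fixed p (hP.gr_ideal.comap_fixed_ne_bot hA hΛ)
  obtain ⟨alg, -, hfin⟩ := exists_finite_algebra_quotient hA hσ hΛ P p rfl
  let _ := Ideal.Quotient.field p
  have hart : IsArtinianRing (Λ ⧸ P) :=
    IsArtinianRing.of_finite (FixedPoints.subring R G ⧸ p) (Λ ⧸ P)
  refine H.eq_top_of_ne_bot ?_ hJ h0
  rintro g h _ ⟨a, ha, rfl⟩ _ ⟨b, hb, rfl⟩ hab
  refine (hP.mem_or_mem hA hΛ a hb fun x => ?_).imp Ideal.Quotient.eq_zero_iff_mem.2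
    Ideal.Quotient.eq_zero_iff_mem.2
  exact Ideal.Quotient.eq_zero_iff_mem.1 (hab (Ideal.Quotient.mk P x))

theorem IsGrPrime.isGrSimple_quotient [MulSemiringAction G R] [IsDedekindDomain R]
    [IsFractionRing R K] (hA : IsCrystallineGraded ι u)
    (hσ : ∀ (g : G) (r : R), u g * baseHom R ι r = baseHom R ι (g • r) * u g)
    (hΛ : IsGradedOrder R ι u Λ) {P : Ideal Λ} [P.IsTwoSided] (hP : IsGrPrime R ι u P) :
    IsGrSimple (quotientComponent ι u P) := by
  classical
  obtain ⟨π, H, -⟩ := exists_isGrading_quotient hA hΛ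
    ((isGradedSet_inAmbient_iff hA hΛ P).1 hP.gr_ideal.graded)
  refine ⟨H.isInternal, H.one_mem, H.mul_mem, Ideal.Quotient.nontrivial_iff.2 hP.proper,
    fun J hJ hgr => or_iff_not_imp_left.2 (hP.quotient_simple hA hσ hΛ H fun x hx g => ?_)⟩
  refine hgr (Finsupp.equivFunOnFinite.symm fun g => π g x) (fun g => H.proj_mem g x) ?_ g
  rw [Finsupp.sum_fintype _ _ fun _ => rfl]
  exact (H.sum_proj x).symm ▸ hx

theorem IsGrPrime.isGrMaximal [MulSemiringAction G R] [IsDedekindDomain R]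
    [IsFractionRing R K] (hA : IsCrystallineGraded ι u)
    (hσ : ∀ (g : G) (r : R), u g * baseHom R ι r = baseHom R ι (g • r) * u g)
    (hΛ : IsGradedOrder R ι u Λ) {P : Ideal Λ} (hP : IsGrPrime R ι u P) :
    IsGrMaximal R ι u P where
  gr_ideal := hP.gr_ideal
  proper := hP.proper
  maximal Q hQ hQtop hPQ := by
    have := hP.gr_ideal.two_sided
    have := hQ.two_sided
    obtain ⟨π, H, hπ⟩ := exists_isGrading_quotient hA hΛ
      ((isGradedSet_inAmbient_iff hA hΛ P).1 hP.gr_ideal.graded)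
    have hQh := (isGradedSet_inAmbient_iff hA hΛ Q).1 hQ.graded
    have hmem : ∀ x, Ideal.Quotient.mk P x ∈ Q.map (Ideal.Quotient.mk P) ↔ x ∈ Q := by
      intro x
      rw [Ideal.mem_map_iff_of_surjective _ Ideal.Quotient.mk_surjective]
      refine ⟨?_, fun hx => ⟨x, hx, rfl⟩⟩
      rintro ⟨y, hy, hyx⟩
      have := Q.sub_mem hy (hPQ (Ideal.Quotient.eq.1 hyx))
      rwa [sub_sub_cancel] at this
    have h2 : (Q.map (Ideal.Quotient.mk P)).IsTwoSided := by
      refine ⟨fun {x} y hx => ?_⟩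
      obtain ⟨x, rfl⟩ := Ideal.Quotient.mk_surjective x
      obtain ⟨y, rfl⟩ := Ideal.Quotient.mk_surjective y
      rw [← map_mul, hmem]
      exact Q.mul_mem_right y ((hmem x).1 hx)
    have hhom : IsHomogeneous π (Q.map (Ideal.Quotient.mk P)) := by
      intro x hx g
      obtain ⟨x, rfl⟩ := Ideal.Quotient.mk_surjective x
      rw [hπ, hmem]
      exact hQh x ((hmem x).1 hx) g
    refine le_antisymm (fun x hx => ?_) hPQ
    by_contra hxP
    refine hQtop ((Ideal.eq_top_iff_one Q).2 ((hmem 1).1 ?_))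
    rw [hP.quotient_simple hA hσ hΛ H hhom fun hbot => hxP ?_]
    · exact Submodule.mem_top
    · have := (hmem x).2 hx
      rw [hbot] at this
      exact Ideal.Quotient.eq_zero_iff_mem.1 this

end Primes

end Crystalline

/-! ### The main theorem -/

theorem mainTheorem10 {R K A G : Type*} [CommRing R] [IsDedekindDomain R]
    [Field K] [Algebra R K] [IsFractionRing R K] [Ring A] [Group G] [Finite G]
    [MulSemiringAction G R] (ι : K →+* A) (u : G → A)
    (hA : Crystalline.IsCrystallineGraded ι u)
    (hσ : ∀ (g : G) (r : R),
      u g * Crystalline.baseHom R ι r = Crystalline.baseHom R ι (g • r) * u g)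
    (Λ : Subring A) (hΛ : Crystalline.IsGradedOrder R ι u Λ) :
    (∀ P : Ideal Λ, Crystalline.IsGrPrime R ι u P ↔ Crystalline.IsGrMaximal R ι u P) ∧
    ∀ (P : Ideal Λ) [P.IsTwoSided], Crystalline.IsGrPrime R ι u P →
      ∀ p : Ideal (FixedPoints.subring R G), p = P.comap (Crystalline.fixedToOrder R hΛ) →
      ∀ Pe : Set A, Pe = ↑(Crystalline.inAmbient P) ∩ ↑(Crystalline.component ι u 1) →
        Pe = ↑(Crystalline.inAmbient P) ∩ Set.range (Crystalline.baseHom R ι) ∧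
        (fun a : FixedPoints.subring R G => Crystalline.baseHom R ι (a : R)) '' p
          = Pe ∩ Set.range (fun a : FixedPoints.subring R G => Crystalline.baseHom R ι (a : R)) ∧
        (Pe = (fun a : FixedPoints.subring R G => Crystalline.baseHom R ι (a : R)) '' p ↔
          ∀ (g : G) (r : R), g • r = r) ∧
        p ≠ ⊥ ∧ p.IsPrime ∧ p.IsMaximal ∧
        (∃ alg : Algebra (FixedPoints.subring R G ⧸ p) (Λ ⧸ P),
          (∀ a : FixedPoints.subring R G,
            algebraMap (FixedPoints.subring R G ⧸ p) (Λ ⧸ P) (Ideal.Quotient.mk p a)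
              = Ideal.Quotient.mk P (Crystalline.fixedToOrder R hΛ a)) ∧
          Module.Finite (FixedPoints.subring R G ⧸ p) (Λ ⧸ P)) ∧
        Crystalline.IsGrSimple (Crystalline.quotientComponent ι u P) := by
  open Crystalline in
  cases nonempty_fintype G
  refine ⟨fun P => ⟨fun hP => hP.isGrMaximal hA hσ hΛ, fun hP => hP.isGrPrime hA hΛ⟩, ?_⟩
  intro P _ hP p hp Pe hPe
  have hbase : Function.Injective (baseHom R ι) :=
    hA.ι_injective.comp (IsFractionRing.injective R K)
  have hPeR : Pe = ↑(inAmbient P) ∩ Set.range (baseHom R ι) := by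
    rw [hPe]
    ext x
    refine and_congr_right fun hx => ⟨?_, ?_⟩
    · rintro ⟨k, rfl⟩
      have hk : ι k * u 1 ∈ inAmbient P := hx
      rw [hA.u_one, mul_one] at hk
      obtain ⟨r, hr⟩ := hΛ.exists_algebraMap_eq hA.ι_injective (mem_inAmbient.1 hk).1
      refine ⟨r, ?_⟩
      change _ = ι k * u 1
      rw [hA.u_one, mul_one, baseHom_apply, hr]
    · rintro ⟨r, rfl⟩
      exact baseHom_mem_component_one hA r
  have hmem : ∀ a : FixedPoints.subring R G, a ∈ p ↔ baseHom R ι (a : R) ∈ inAmbient P := by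
    intro a
    rw [hp, mem_inAmbient]
    exact ⟨fun h => ⟨hΛ.baseHom_mem R a, h⟩, fun h => h.2⟩
  have hpPe : (fun a : FixedPoints.subring R G => baseHom R ι (a : R)) '' p
      = Pe ∩ Set.range (fun a : FixedPoints.subring R G => baseHom R ι (a : R)) := by
    rw [hPeR]
    ext x
    constructor
    · rintro ⟨a, ha, rfl⟩
      exact ⟨⟨(hmem a).1 ha, a, rfl⟩, a, rfl⟩
    · rintro ⟨⟨hx, -⟩, a, rfl⟩
      exact ⟨a, (hmem a).2 hx, rfl⟩
  have hp0 : p ≠ ⊥ := hp ▸ hP.gr_ideal.comap_fixed_ne_bot hA hΛ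
  have hpp : p.IsPrime := hp ▸ hP.isPrime_comap_fixed hA hσ hΛ
  have hpm : p.IsMaximal := isMaximal_of_isPrime_fixed p hp0
  refine ⟨hPeR, hpPe, ⟨fun heq g r => ?_, fun htriv => ?_⟩, hp0, hpp, hpm,
    exists_finite_algebra_quotient hA hσ hΛ P p hp, hP.isGrSimple_quotient hA hσ hΛ⟩
  -- If `P_e = p`, every element of `P ∩ R` is invariant; applied to `t` and `r t` with `t ≠ 0`,
  -- this makes `r` invariant.
  · obtain ⟨t, ht0, ht⟩ := hP.gr_ideal.exists_baseHom_mem hA hΛ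
    have hfix : ∀ s : R, baseHom R ι s ∈ inAmbient P → g • s = s := by
      intro s hs
      have hsPe : baseHom R ι s ∈ Pe := hPeR ▸ ⟨hs, s, rfl⟩
      rw [heq] at hsPe
      obtain ⟨a, -, ha⟩ := hsPe
      rw [← hbase ha]
      exact smul_coe_fixed g a
    have h1 := hfix (r * t) (by
      rw [map_mul]
      exact hP.gr_ideal.full.left_mem r _ ht)
    rw [smul_mul', hfix t ht] at h1
    exact mul_right_cancel₀ ht0 h1
  · rw [hpPe, eq_comm, Set.inter_eq_left, hPeR]
    rintro _ ⟨-, r, rfl⟩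
    exact ⟨⟨r, fun g => htriv g r⟩, rfl⟩
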